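/- Let $G$ be a finite abelian group, let $n\ge 0$, and let $G_n=G^n\rtimes\mathfrak S_n$ be the wreath product, where $\sigma\cdot(g_1,\dots,g_n)=(g_{\sigma^{-1}(1)},\dots,g_{\sigma^{-1}(n)})\cdot\sigma$. Identify $\sigma\cdot(g_1,\dots,g_n)\in G_n$ with the coloured word $\sigma(1)^{g_1}\sigma(2)^{g_2}\cdots\sigma(n)^{g_n}$, and let $w_1^{g_1}\cdot w_2^{g_2}\cdots w_k^{g_k}$ (now with one colour $g_i$ for each factor $w_i$) be its rainbow decomposition, that is, its factorization into maximal non-empty factors of constant colour. For an injective word $w=a_1\cdots a_m$ in a totally ordered alphabet put $\mathrm{Des}(w)=\{i\in[1,m-1] : a_i>a_{i+1}\}$ and $\mathring{\mathrm{peak}}(w)=\{i\in[2,m-1] : a_{i-1}<a_i>a_{i+1}\}$, and let $D(w)$ and $\mathring P(w)$ be the compositions of $m$ corresponding to these two sets, where $\{i_1<\dots<i_r\}\subseteq[1,m-1]$ corresponds to $(i_1,i_2-i_1,\dots,m-i_r)$. For a composition $\mathbf c=(c_1,\dots,c_r)$ and $g\in G$ write $\mathbf c^g=(c_1^g,\dots,c_r^g)$.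 The $G$-descent composition and the $G$-peak composition of a coloured permutation $\alpha\in G_n$ with rainbow decomposition $w_1^{g_1}\cdots w_k^{g_k}$ are the concatenations $$D_G(\alpha)=D(w_1)^{g_1}\cdots D(w_k)^{g_k},\qquad \mathring P_G(\alpha)=\mathring P(w_1)^{g_1}\cdots\mathring P(w_k)^{g_k}.$$ Let $\mathring\Pi_n(G)$ be the set of all $\mathring P_G(\alpha)$, $\alpha\in G_n$. In the group ring $\mathbb Z G_n$ put $d^G_{\mathbf c}=\sum_{D_G(\alpha)=\mathbf c}\alpha$ for each $G$-composition $\mathbf c$ of $n$ (a finite word of positive integers with sum $n$, each carrying a colour in $G$), and $\mathring p^G_{\mathbf c}=\sum_{\mathring P_G(\alpha)=\mathbf c}\alpha$ for $\mathbf c\in\mathring\Pi_n(G)$. Let $\Sigma_n(G)$ (the Mantaci–Reutenauer algebra) be the $\mathbb Z$-span of the elements $d^G_{\mathbf c}$. **Theorem.** The elements $\mathring p^G_{\mathbf c}$, $\mathbf c\in\mathring\Pi_n(G)$, are linearly independent over $\mathbb Z$, and their span $$\mathring{\mathcal P}_n(G)=\bigoplus_{\mathbf c\in\mathring\Pi_n(G)}\mathbb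 Z\,\mathring p^G_{\mathbf c}$$ is a (non-unitary) subalgebra of $\mathbb Z G_n$ contained in $\Sigma_n(G)$, that is, it is closed under multiplication and $\mathring{\mathcal P}_n(G)\subseteq\Sigma_n(G)$; moreover, if $n\ge 2$, it does not contain the identity of $\mathbb Z G_n$. -/

import Mathlib

namespace ColouredPeak

section Words

variable {A : Type*} [LinearOrder A]

/-- The descent set of a word `w = a₁ a₂ ⋯ aₙ`, as a subset of `[1, n-1]`: the index `i : Fin (n-1)`
stands for the position `i + 1`. Thus `i` belongs to the set iff `a_{i+1} > a_{i+2}`.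
Standardizing a word does not change the descent set. -/
def descentSet (w : List A) : Finset (Fin (w.length - 1)) :=
  Finset.univ.filter fun i =>
    w[(i : ℕ) + 1]'(by omega) < w[(i : ℕ)]'(by omega)

/-- The (interior) peak set of a word `w = a₁ a₂ ⋯ aₙ`, as a subset of `[1, n-1]`: the index
`i : Fin (n-1)` stands for the position `p = i + 1`. It is a peak iff `p > 1` and
`a_{p-1} < a_p > a_{p+1}`. For injective words (all words below are injective), standardizing the
word does not change the peak set. -/
def peakSet (w : List A) : Finset (Fin (w.length - 1)) :=
  Finset.univ.filter fun i =>
    0 < (i : ℕ) ∧ w[(i : ℕ) - 1]'(by omega) < w[(i : ℕ)]'(by omega) ∧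
      w[(i : ℕ) + 1]'(by omega) < w[(i : ℕ)]'(by omega)

/-- The composition `(i₁, i₂ - i₁, …, n - i_k)` of `n` that corresponds to the subset
`I = {i₁ < ⋯ < i_k}` of `[1, n-1]` (with `i : Fin (n-1)` standing for `i + 1`). -/
def compositionOfSet (n : ℕ) (I : Finset (Fin (n - 1))) : Composition n :=
  ((compositionAsSetEquiv n).symm I).toComposition

/-- The descent composition of a word. -/
def descentComposition (w : List A) : Composition w.length :=
  compositionOfSet w.length (descentSet w)

/-- The (interior) peak composition of a word. -/
def peakComposition (w : List A) : Composition w.length :=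
  compositionOfSet w.length (peakSet w)

variable {G : Type*} [DecidableEq G]

/-- The rainbow decomposition of a coloured word: its decomposition into maximal non-empty factors
of constant colour. -/
def rainbow (w : List (A × G)) : List (List (A × G)) :=
  w.splitBy fun a b => decide (a.2 = b.2)

/-- Given a monochromatic coloured word `u^g` and a map `ρ` from words to compositions, the
`G`-composition `ρ(u)^g`. -/
def blockComposition (ρ : (u : List A) → Composition u.length) : List (A × G) → List (ℕ × G)
  | [] => []
  | a :: w => (ρ ((a :: w).map Prod.fst)).blocks.map fun c => (c, a.2)

/-- `ρ(w₁)^{g₁} · ρ(w₂)^{g₂} ⋯ ρ(w_k)^{g_k}` where `w₁^{g₁} · w₂^{g₂} ⋯ w_k^{g_k}` is the rainbow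
decomposition of the given coloured word. -/
def colouredComposition (ρ : (u : List A) → Composition u.length) (w : List (A × G)) :
    List (ℕ × G) :=
  (rainbow w).flatMap (blockComposition ρ)

end Words

/-- A `G`-composition of `n`: a word of pairs (positive integer, colour) whose integers sum
to `n`. -/
def IsGComposition {G : Type*} (n : ℕ) (c : List (ℕ × G)) : Prop :=
  (∀ p ∈ c, 0 < p.1) ∧ (c.map Prod.fst).sum = n

/-- The group `G_n = Gⁿ ⋊ 𝔖_n` of coloured permutations; `σ ∈ 𝔖_n` acts on `Gⁿ` by
`(σ • g) i = g (σ⁻¹ i)`. -/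
abbrev ColPerm (G : Type*) [CommGroup G] (n : ℕ) : Type _ :=
  SemidirectProduct (Fin n → G) (Equiv.Perm (Fin n))
    (mulAutArrow (G := Equiv.Perm (Fin n)) (A := Fin n) (M := G))

section ColouredPermutations

variable {G : Type*} [CommGroup G] {n : ℕ}

/-- The coloured word `σ(1)^{g₁} ⋯ σ(n)^{gₙ}` of the coloured permutation `σ · (g₁, …, gₙ)`.
In the semidirect product `σ · g = (σ • g) · σ`, whence `gᵢ = (left component) (σ i)`; see
`word_inr_mul_inl`. -/
def word (α : ColPerm G n) : List (Fin n × G) :=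
  List.ofFn fun i => (α.right i, α.left (α.right i))

theorem word_inr_mul_inl (σ : Equiv.Perm (Fin n)) (g : Fin n → G) :
    word (SemidirectProduct.inr σ * SemidirectProduct.inl g : ColPerm G n)
      = List.ofFn fun i => (σ i, g i) := by
  refine congrArg List.ofFn (funext fun i => ?_)
  refine Prod.ext ?_ ?_
  · change σ ((1 : Equiv.Perm (Fin n)) i) = σ i
    rfl
  · change (1 : G) * g (σ⁻¹ (σ ((1 : Equiv.Perm (Fin n)) i))) = g i
    simp

variable [DecidableEq G]

/-- The `G`-descent composition of a coloured permutation. -/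
def gDescentComposition (α : ColPerm G n) : List (ℕ × G) :=
  colouredComposition descentComposition (word α)

/-- The `G`-peak composition of a coloured permutation. -/
def gPeakComposition (α : ColPerm G n) : List (ℕ × G) :=
  colouredComposition peakComposition (word α)

end ColouredPermutations

noncomputable instance (G : Type*) [CommGroup G] [Fintype G] (n : ℕ) : Fintype (ColPerm G n) :=
  Fintype.ofEquiv _ (SemidirectProduct.equivProd
    (φ := mulAutArrow (G := Equiv.Perm (Fin n)) (A := Fin n) (M := G))).symm

section Algebras

variable (G : Type*) [CommGroup G] [Fintype G] [DecidableEq G] (n : ℕ)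

/-- The set of `G`-peak compositions of the elements of `G_n`. -/
def gPeakCompositions : Set (List (ℕ × G)) :=
  Set.range (gPeakComposition : ColPerm G n → List (ℕ × G))

variable {G}

/-- The sum in `ℤ G_n` of all coloured permutations with `G`-descent composition `c`. -/
noncomputable def descentElement (c : List (ℕ × G)) : MonoidAlgebra ℤ (ColPerm G n) :=
  ∑ α : ColPerm G n with gDescentComposition α = c, MonoidAlgebra.of ℤ (ColPerm G n) α

/-- The sum in `ℤ G_n` of all coloured permutations with `G`-peak composition `c`. -/
noncomputable def peakElement (c : List (ℕ × G)) : MonoidAlgebra ℤ (ColPerm G n) :=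
  ∑ α : ColPerm G n with gPeakComposition α = c, MonoidAlgebra.of ℤ (ColPerm G n) α

variable (G)

/-- The Mantaci–Reutenauer algebra `Σ_n(G)`, as a `ℤ`-submodule of `ℤ G_n`: the span of the
descent elements of all `G`-compositions of `n`. -/
noncomputable def mantaciReutenauer : Submodule ℤ (MonoidAlgebra ℤ (ColPerm G n)) :=
  Submodule.span ℤ (descentElement n '' {c : List (ℕ × G) | IsGComposition n c})

/-- The span in `ℤ G_n` of the coloured peak elements of all `G`-peak compositions. -/
noncomputable def peakModule : Submodule ℤ (MonoidAlgebra ℤ (ColPerm G n)) :=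
  Submodule.span ℤ (peakElement n '' gPeakCompositions G n)

end Algebras

end ColouredPeak

/-! A `G`-peak composition records exactly the colours of the letters and the positions of the peaks
inside monochromatic factors (`gPeakComposition_eq_iff`). The peak elements thus have disjoint
supports, and their span consists of the elements whose coefficients depend on these data only
(`mem_peakModule_iff`). Since descents and colours determine peaks, the span lies in the
Mantaci–Reutenauer algebra.

Closure under products follows the idea of enriched `P`-partitions. Label the positions weakly
increasingly, with a colour attached to each label, and weight a coloured permutation by its
compatible signings. In a block of equal labels, negative letters come first and decrease, then
positive letters increase. So there is no signing if a block has an interior peak, and otherwise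
there are `2 ^ (number of blocks)` (`card_signings_mul`). A product of two such elements counts
pairs of signings. These correspond bijectively to signings for refined labels
(`sum_card_signings_mul`), so the product again depends only on colours and peaks
(`signedElement_mul_mem`). Finally, the weighted sums generate the peak elements up to division by
nonzero integers, by a triangularity argument (`exists_label`,
`peakModule_le_of_signedElement_mem`), and the peak module is closed under such division. -/

namespace ColouredPeak

/-! ### `G`-compositions as marked coloured words -/

section Expansion

variable {G : Type*}

/-- The coloured word with marked letters that encodes a `G`-composition: each part `c^g`
contributes `c` letters of colour `g`, of which only the last is marked. -/
def expand : List (ℕ × G) → List (G × Bool)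
  | [] => []
  | (c, g) :: l => List.replicate (c - 1) (g, false) ++ (g, true) :: expand l

theorem expand_append (l l' : List (ℕ × G)) : expand (l ++ l') = expand l ++ expand l' := by
  induction l with
  | nil => rfl
  | cons p l ih => obtain ⟨c, g⟩ := p; simp [expand, ih]

theorem expand_flatMap {B : Type*} (f : B → List (ℕ × G)) (L : List B) :
    expand (L.flatMap f) = L.flatMap fun b => expand (f b) := by
  induction L with
  | nil => rfl
  | cons b L ih => simp [expand_append, ih]

theorem length_expand (l : List (ℕ × G)) (hl : ∀ p ∈ l, 0 < p.1) :
    (expand l).length = (l.map Prod.fst).sum := by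
  induction l with
  | nil => rfl
  | cons p l ih =>
    obtain ⟨c, g⟩ := p
    have := hl (c, g) (by simp)
    simp only [List.mem_cons, forall_eq_or_imp] at hl
    simp [expand, ih hl.2]
    omega

theorem replicate_append_cons_inj {a b : ℕ} {g h : G} {l l' : List (G × Bool)}
    (H : List.replicate a (g, false) ++ (g, true) :: l =
      List.replicate b (h, false) ++ (h, true) :: l') : a = b ∧ g = h ∧ l = l' := by
  induction a generalizing b with
  | zero =>
    cases b with
    | zero => simpa using H
    | succ b => simp [List.replicate_succ] at H
  | succ a ih =>
    cases b with
    | zero => simp [List.replicate_succ] at H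
    | succ b =>
      simp only [List.replicate_succ, List.cons_append, List.cons.injEq] at H
      obtain ⟨h1, h2, h3⟩ := ih H.2
      exact ⟨by rw [h1], h2, h3⟩

/-- The marks show where parts end. Positivity matters: parts `0` and `1` would expand alike. -/
theorem expand_injOn {l l' : List (ℕ × G)} (hl : ∀ p ∈ l, 0 < p.1) (hl' : ∀ p ∈ l', 0 < p.1)
    (h : expand l = expand l') : l = l' := by
  induction l generalizing l' with
  | nil =>
    cases l' with
    | nil => rfl
    | cons p l' => obtain ⟨c, g⟩ := p; simp [expand] at h
  | cons p l ih =>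
    obtain ⟨c, g⟩ := p
    cases l' with
    | nil => simp [expand] at h
    | cons p' l' =>
      obtain ⟨c', g'⟩ := p'
      simp only [List.mem_cons, forall_eq_or_imp] at hl hl'
      obtain ⟨h1, h2, h3⟩ := replicate_append_cons_inj h
      rw [ih hl.2 hl'.2 h3, h2, show c = c' by omega]

theorem getElem?_expand_map (g : G) (b : List ℕ) (hb : ∀ c ∈ b, 0 < c) (j : ℕ)
    (hj : j < b.sum) :
    (expand (b.map fun c => (c, g)))[j]? =
      some (g, decide (∃ i ≤ b.length, (b.take i).sum = j + 1)) := by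
  induction b generalizing j with
  | nil => simp at hj
  | cons c b ih =>
    simp only [List.mem_cons, forall_eq_or_imp] at hb
    simp only [List.sum_cons] at hj
    simp only [List.map_cons, expand]
    have key : (∃ i ≤ (c :: b).length, ((c :: b).take i).sum = j + 1) ↔
        ∃ i ≤ b.length, c + (b.take i).sum = j + 1 := by
      constructor
      · rintro ⟨i, hi, h⟩
        cases i with
        | zero => simp at h
        | succ i => exact ⟨i, by simpa using hi, by simpa using h⟩
      · rintro ⟨i, hi, h⟩
        exact ⟨i + 1, by simpa using hi, by simpa using h⟩
    rw [Bool.decide_congr key]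
    rcases lt_trichotomy j (c - 1) with h | h | h
    · rw [List.getElem?_append_left (by simpa using h)]
      simp only [List.getElem?_replicate, h, if_true, Option.some.injEq, Prod.mk.injEq,
        true_and]
      symm
      simp only [decide_eq_false_iff_not]
      rintro ⟨i, -, hi⟩
      omega
    · rw [List.getElem?_append_right (by simp [h])]
      simp only [List.length_replicate, h, Nat.sub_self, List.getElem?_cons_zero,
        Option.some.injEq, Prod.mk.injEq, true_and]
      symm
      simp only [decide_eq_true_eq]
      exact ⟨0, by simp, by simp; omega⟩
    · rw [List.getElem?_append_right (by simp; omega)]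
      obtain ⟨k, rfl⟩ : ∃ k, j = c + k := ⟨j - c, by omega⟩
      rw [List.length_replicate, show c + k - (c - 1) = k + 1 by omega, List.getElem?_cons_succ,
        ih hb.2 k (by omega)]
      simp only [add_assoc, Nat.add_left_cancel_iff]

end Expansion

/-- Partial sums of the blocks are the boundaries: the outer ones `0` and `n`, and `k + 1` for `k ∈
I`. Writing `j + 1` excludes `0`. -/
theorem exists_take_sum_blocks_compositionOfSet {n : ℕ} (I : Finset (Fin (n - 1))) {j : ℕ}
    (hj : j < n) :
    (∃ i ≤ (compositionOfSet n I).blocks.length,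
      ((compositionOfSet n I).blocks.take i).sum = j + 1) ↔
      j + 1 = n ∨ ∃ k ∈ I, (k : ℕ) = j := by
  set c := (compositionAsSetEquiv n).symm I with hc
  have h := c.mem_boundaries_iff_exists_blocks_sum_take_eq (j := ⟨j + 1, by omega⟩)
  rw [c.card_boundaries_eq_succ_length] at h
  have hb : (⟨j + 1, by omega⟩ : Fin n.succ) ∈ c.boundaries ↔
      j + 1 = n ∨ ∃ k ∈ I, (k : ℕ) = j := by
    have hB : c.boundaries = {i : Fin n.succ | i = 0 ∨ i = Fin.last n ∨
        ∃ (k : Fin (n - 1)) (_ : k ∈ I), (i : ℕ) = k + 1}.toFinset := rfl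
    rw [hB, Set.mem_toFinset]
    constructor
    · rintro (h | h | ⟨k, hk, h⟩)
      · exact absurd (congrArg Fin.val h) (by simp)
      · exact Or.inl (congrArg Fin.val h)
      · exact Or.inr ⟨k, hk, by simpa using h.symm⟩
    · rintro (h | ⟨k, hk, rfl⟩)
      · exact Or.inr (Or.inl (Fin.ext h))
      · exact Or.inr (Or.inr ⟨k, hk, rfl⟩)
  rw [← hb, h]
  have hl : c.blocks.length = c.length := by simp [CompositionAsSet.blocks]
  change (∃ i ≤ c.blocks.length, (c.blocks.take i).sum = j + 1) ↔ _
  rw [hl]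
  simp

/-! ### Local rules and the rainbow decomposition -/

section Flags

variable {A G : Type*} [DecidableEq G]

/-- The colours of the letters of a coloured word, each with a mark: a letter is marked if it ends
a monochromatic factor, or if `q` holds for its left neighbour of the same colour (if any), the
letter itself and its right neighbour. -/
def flags (q : Option A → A → A → Prop) [∀ o a b, Decidable (q o a b)] :
    Option A → List (A × G) → List (G × Bool)
  | _, [] => []
  | _, [a] => [(a.2, true)]
  | o, a :: b :: w =>
    if a.2 = b.2 then (a.2, decide (q o a.1 b.1)) :: flags q (some a.1) (b :: w)
    else (a.2, true) :: flags q none (b :: w)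

variable (q : Option A → A → A → Prop) [∀ o a b, Decidable (q o a b)]

theorem length_flags (o : Option A) (w : List (A × G)) : (flags q o w).length = w.length := by
  induction w generalizing o with
  | nil => rfl
  | cons a w ih =>
    cases w with
    | nil => rfl
    | cons b w =>
      simp only [flags]
      split_ifs <;> simp [ih]

/-- No information crosses a colour change: the last letter of `u` is marked regardless of `q`, and
`w` starts without a left neighbour. -/
theorem flags_append (o : Option A) (u w : List (A × G)) (hu : u ≠ [])
    (huc : u.IsChain fun a b => a.2 = b.2)
    (h : ∀ b ∈ w.head?, (u.getLast hu).2 ≠ b.2) :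
    flags q o (u ++ w) = flags q o u ++ flags q none w := by
  induction u generalizing o with
  | nil => exact absurd rfl hu
  | cons a u ih =>
    cases u with
    | nil =>
      cases w with
      | nil => rfl
      | cons b w =>
        have : a.2 ≠ b.2 := by simpa using h
        simp [flags, this]
    | cons b u =>
      rw [List.isChain_cons_cons] at huc
      have := ih (some a.1) (by simp) huc.2 (by simpa using h)
      simp only [List.cons_append] at this ⊢
      simp [flags, huc.1, this]

/-- The left neighbour of the letter at position `i` in a coloured word, if it has the same
colour. -/
def leftNeighbour (o : Option A) (w : List (A × G)) (i : ℕ) (hi : i < w.length) : Option A :=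
  if i = 0 then o else if w[i - 1].2 = w[i].2 then some w[i - 1].1 else none

theorem getElem?_flags (o : Option A) (w : List (A × G)) (i : ℕ) (hi : i < w.length) :
    (flags q o w)[i]? = some (w[i].2, if h : i + 1 < w.length then
      (if w[i].2 = w[i + 1].2 then decide (q (leftNeighbour o w i hi) w[i].1 w[i + 1].1)
        else true) else true) := by
  induction w generalizing o i with
  | nil => simp at hi
  | cons a w ih =>
    cases w with
    | nil =>
      obtain rfl : i = 0 := by simpa using hi
      simp [flags]
    | cons b w =>
      cases i with
      | zero =>
        simp only [flags]
        split_ifs <;> simp_all [leftNeighbour]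
      | succ i =>
        have hi' : i < (b :: w).length := by simpa using hi
        have hL : leftNeighbour (if a.2 = b.2 then some a.1 else none) (b :: w) i hi' =
            leftNeighbour o (a :: b :: w) (i + 1) hi := by
          unfold leftNeighbour
          cases i with
          | zero => simp
          | succ i => simp
        have hF : flags q o (a :: b :: w) =
            (a.2, if a.2 = b.2 then decide (q o a.1 b.1) else true) ::
              flags q (if a.2 = b.2 then some a.1 else none) (b :: w) := by
          simp only [flags]
          split_ifs <;> rfl
        rw [hF, List.getElem?_cons_succ, ih _ i hi', hL]
        simp

theorem flags_flatten (L : List (List (A × G))) (hn : [] ∉ L)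
    (hm : ∀ u ∈ L, u.IsChain fun a b => a.2 = b.2)
    (hc : L.IsChain fun u v => ∃ hu hv, (u.getLast hu).2 ≠ (v.head hv).2) :
    flags q none L.flatten = L.flatMap (flags q none) := by
  induction L with
  | nil => rfl
  | cons u L ih =>
    simp only [List.mem_cons, not_or, forall_eq_or_imp] at hn hm
    rw [List.flatten_cons, List.flatMap_cons, flags_append q none u _ (Ne.symm hn.1) hm.1,
      ih hn.2 hm.2 hc.tail]
    intro b hb
    cases L with
    | nil => simp at hb
    | cons v L =>
      obtain ⟨hu, hv, h⟩ := (List.isChain_cons_cons.1 hc).1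
      cases v with
      | nil => exact absurd rfl hv
      | cons x v =>
        simp only [List.flatten_cons, List.cons_append, List.head?_cons, Option.mem_def,
          Option.some.injEq] at hb
        rw [← hb]
        exact h

/-- The composition-valued map `u ↦ compositionOfSet u.length (S u)` is local with rule `q` if
membership in `S u` is decided by `q` from neighbouring letters. -/
def IsLocal (S : (u : List A) → Finset (Fin (u.length - 1))) : Prop :=
  ∀ (u : List A) (i : Fin (u.length - 1)), i ∈ S u ↔
    q (if (i : ℕ) = 0 then none else some (u[(i : ℕ) - 1]'(by omega)))
      (u[(i : ℕ)]'(by omega)) (u[(i : ℕ) + 1]'(by omega))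

variable {q} {S : (u : List A) → Finset (Fin (u.length - 1))}

theorem expand_blockComposition (hS : IsLocal q S) (u : List (A × G))
    (hu : u.IsChain fun a b => a.2 = b.2) :
    expand (blockComposition (fun v => compositionOfSet v.length (S v)) u) = flags q none u := by
  cases u with
  | nil => rfl
  | cons a u =>
    have hcol : ∀ (i : ℕ) (hi : i < (a :: u).length), (a :: u)[i].2 = a.2 := by
      intro i hi
      induction i with
      | zero => rfl
      | succ i ih => rw [← ih (by omega)]; exact (List.isChain_iff_getElem.1 hu i hi).symm
    set v := (a :: u).map Prod.fst with hv
    have hlen : v.length = (a :: u).length := by simp [hv]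
    apply List.ext_getElem?
    intro j
    simp only [blockComposition]
    by_cases hj : j < (a :: u).length
    · rw [getElem?_expand_map _ _ (fun c hc => Composition.blocks_pos _ hc) _
        (by rw [Composition.blocks_sum]; simpa [hv] using hj), getElem?_flags q none _ j hj]
      simp only [hcol, if_true]
      rw [Option.some.injEq, Prod.mk.injEq]
      refine ⟨rfl, ?_⟩
      have := exists_take_sum_blocks_compositionOfSet (S v) (j := j) (by rw [hlen]; exact hj)
      rw [← hv]
      rw [Bool.decide_congr this]
      by_cases h1 : j + 1 < (a :: u).length
      · rw [dif_pos h1]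
        apply decide_eq_decide.2
        have h2 := hS v ⟨j, by omega⟩
        have h3 : j + 1 ≠ v.length := by omega
        have h4 : (∃ k ∈ S v, (k : ℕ) = j) ↔ (⟨j, by omega⟩ : Fin (v.length - 1)) ∈ S v :=
          ⟨by rintro ⟨k, hk, rfl⟩; exact hk, fun h => ⟨_, h, rfl⟩⟩
        rw [or_iff_right h3, h4, h2]
        simp only [leftNeighbour, hcol, if_true, hv, List.getElem_map]
      · rw [dif_neg h1, decide_eq_true_eq]
        left; omega
    · rw [List.getElem?_eq_none, List.getElem?_eq_none]
      · rw [length_flags]; omega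
      · rw [length_expand]
        · simp [Function.comp_def]
          simp at hj; simpa using hj
        · simp only [List.mem_map]
          rintro p ⟨c, hc, rfl⟩
          exact Composition.blocks_pos _ hc

theorem pos_of_mem_colouredComposition (ρ : (u : List A) → Composition u.length)
    (w : List (A × G)) : ∀ p ∈ colouredComposition ρ w, 0 < p.1 := by
  intro p hp
  simp only [colouredComposition, List.mem_flatMap] at hp
  obtain ⟨u, -, hu⟩ := hp
  cases u with
  | nil => simp [blockComposition] at hu
  | cons a u =>
    simp only [blockComposition, List.mem_map] at hu
    obtain ⟨c, hc, rfl⟩ := hu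
    exact Composition.blocks_pos _ hc

/-- Replaces the factor-by-factor definition by a single scan of the whole word. -/
theorem expand_colouredComposition (hS : IsLocal q S) (w : List (A × G)) :
    expand (colouredComposition (fun v => compositionOfSet v.length (S v)) w) =
      flags q none w := by
  have hm : ∀ u ∈ rainbow w, u.IsChain fun a b => a.2 = b.2 := by
    intro u hu
    simpa using List.isChain_of_mem_splitBy hu
  conv_rhs => rw [← List.flatten_splitBy (fun a b : A × G => decide (a.2 = b.2)) w]
  rw [flags_flatten q _ (List.nil_notMem_splitBy _ _) hm
    (by simpa using List.isChain_getLast_head_splitBy (fun a b : A × G => decide (a.2 = b.2)) w),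
    colouredComposition, expand_flatMap]
  exact List.flatMap_congr fun u hu => expand_blockComposition hS u (hm u hu)

theorem isGComposition_colouredComposition (hS : IsLocal q S) (w : List (A × G)) :
    IsGComposition w.length
      (colouredComposition (fun v => compositionOfSet v.length (S v)) w) := by
  refine ⟨pos_of_mem_colouredComposition _ _, ?_⟩
  rw [← length_expand _ (pos_of_mem_colouredComposition _ _), expand_colouredComposition hS,
    length_flags]

theorem colouredComposition_eq_iff (hS : IsLocal q S) (w w' : List (A × G)) :
    colouredComposition (fun v => compositionOfSet v.length (S v)) w =
      colouredComposition (fun v => compositionOfSet v.length (S v)) w' ↔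
    flags q none w = flags q none w' := by
  rw [← expand_colouredComposition hS, ← expand_colouredComposition hS]
  exact ⟨fun h => by rw [h], expand_injOn (pos_of_mem_colouredComposition _ _)
    (pos_of_mem_colouredComposition _ _)⟩

end Flags

section LocalRules

variable {A : Type*} [LinearOrder A]

/-- The local rule of the interior peak set. -/
def peakRule : Option A → A → A → Prop
  | none, _, _ => False
  | some p, a, b => p < a ∧ b < a

instance : ∀ (o : Option A) (a b : A), Decidable (peakRule o a b)
  | none, _, _ => inferInstanceAs (Decidable False)
  | some p, a, b => inferInstanceAs (Decidable (p < a ∧ b < a))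

/-- The local rule of the descent set. -/
def descentRule (_ : Option A) (a b : A) : Prop := b < a

instance (o : Option A) (a b : A) : Decidable (descentRule o a b) :=
  inferInstanceAs (Decidable (b < a))

theorem isLocal_peakSet : IsLocal (peakRule (A := A)) peakSet := by
  intro u i
  by_cases h : (i : ℕ) = 0
  · simp [peakSet, peakRule, h]
  · simp [peakSet, peakRule, h, Nat.pos_of_ne_zero h]

theorem isLocal_descentSet : IsLocal (descentRule (A := A)) descentSet := by
  intro u i
  simp [descentSet, descentRule]

end LocalRules

/-! ### Peak and descent compositions in terms of positions -/

section ColouredPermutations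

variable {G : Type*} [CommGroup G] {n : ℕ}

/-- The colour of the `i`-th letter of a coloured permutation. -/
def col (γ : ColPerm G n) (i : Fin n) : G := γ.left (γ.right i)

/-- The `i`-th letter is larger than its two neighbours, and the three have the same colour. -/
def IsPeak (γ : ColPerm G n) (i : Fin n) : Prop :=
  ∃ a b : Fin n, (a : ℕ) + 1 = i ∧ (i : ℕ) + 1 = b ∧ col γ a = col γ i ∧ col γ i = col γ b ∧
    γ.right a < γ.right i ∧ γ.right b < γ.right i

/-- The `i`-th letter is larger than the next one, which has the same colour. -/
def IsDescent (γ : ColPerm G n) (i : Fin n) : Prop :=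
  ∃ b : Fin n, (i : ℕ) + 1 = b ∧ col γ i = col γ b ∧ γ.right b < γ.right i

/-- Makes peaks a function of colours and descents, which is why peak elements are sums of descent
elements. -/
theorem isPeak_iff_isDescent (γ : ColPerm G n) (i : Fin n) :
    IsPeak γ i ↔ IsDescent γ i ∧
      ∃ a : Fin n, (a : ℕ) + 1 = i ∧ col γ a = col γ i ∧ ¬ IsDescent γ a := by
  constructor
  · rintro ⟨a, b, ha, hb, hac, hbc, hal, hbl⟩
    refine ⟨⟨b, hb, hbc, hbl⟩, a, ha, hac, ?_⟩
    rintro ⟨i', hi', -, h⟩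
    obtain rfl : i = i' := Fin.ext (ha.symm.trans hi')
    exact lt_asymm h hal
  · rintro ⟨⟨b, hb, hbc, hbl⟩, a, ha, hac, h⟩
    refine ⟨a, b, ha, hb, hac, hbc, ?_, hbl⟩
    refine lt_of_le_of_ne (not_lt.1 fun h' => h ⟨i, ha, hac, h'⟩) fun h' => ?_
    have := γ.right.injective h'
    subst this
    omega

@[simp] theorem length_word (γ : ColPerm G n) : (word γ).length = n := by simp [word]

theorem getElem_word (γ : ColPerm G n) (i : ℕ) (hi : i < (word γ).length) :
    (word γ)[i] = (γ.right ⟨i, by simpa using hi⟩, col γ ⟨i, by simpa using hi⟩) := by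
  simp [word, col]

variable [DecidableEq G] (q : Option (Fin n) → Fin n → Fin n → Prop)
  [∀ o a b, Decidable (q o a b)]

/-- The rule `q` holds at the `i`-th letter of a coloured permutation, and the next letter has the
same colour. -/
def Marked (γ : ColPerm G n) (i : Fin n) : Prop :=
  ∃ b : Fin n, (i : ℕ) + 1 = b ∧ col γ i = col γ b ∧
    q (leftNeighbour none (word γ) i (by simp)) (γ.right i) (γ.right b)

theorem flags_word_eq_iff (γ γ' : ColPerm G n) :
    flags q none (word γ) = flags q none (word γ') ↔
      col γ = col γ' ∧ ∀ i, Marked q γ i ↔ Marked q γ' i := by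
  classical
  have key : ∀ (γ : ColPerm G n) (i : Fin n), (flags q none (word γ))[(i : ℕ)]? =
      some (col γ i, decide ((∀ b : Fin n, (i : ℕ) + 1 = b → col γ i ≠ col γ b) ∨
        Marked q γ i)) := by
    intro γ i
    rw [getElem?_flags q none (word γ) i (by simp), getElem_word]
    congr 2
    by_cases h : (i : ℕ) + 1 < n
    · rw [dif_pos (by simpa using h)]
      have hb : ∀ b : Fin n, (i : ℕ) + 1 = b ↔ b = ⟨i + 1, h⟩ := fun b => by
        rw [Fin.ext_iff]; exact eq_comm
      simp only [getElem_word, hb, Marked, forall_eq, exists_eq_left]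
      split_ifs with h' <;> simp [h']
    · rw [dif_neg (by simpa using h)]
      symm
      rw [decide_eq_true_iff]
      exact Or.inl fun b hb => absurd b.2 (by omega)
  -- The two reasons for a mark exclude each other, and the first depends only on colours; so it can
  -- be stripped off.
  have hex : ∀ (γ : ColPerm G n) (i : Fin n), Marked q γ i →
      ¬ ∀ b : Fin n, (i : ℕ) + 1 = b → col γ i ≠ col γ b :=
    fun γ i ⟨b, hb, hc, _⟩ h => h b hb hc
  constructor
  · intro h
    have h' : ∀ i : Fin n, _ := fun i => by
      have := congrArg (fun l => l[(i : ℕ)]?) h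
      simp only [key, Option.some.injEq, Prod.mk.injEq, decide_eq_decide] at this
      exact this
    have hc : col γ = col γ' := funext fun i => (h' i).1
    refine ⟨hc, fun i => ?_⟩
    have h1 := (h' i).2
    have h2 := hex γ i
    have h3 := hex γ' i
    rw [hc] at h1 h2
    tauto
  · rintro ⟨hc, hm⟩
    apply List.ext_getElem?
    intro i
    by_cases hi : i < n
    · have h1 := key γ ⟨i, hi⟩
      have h2 := key γ' ⟨i, hi⟩
      simp only at h1 h2
      rw [h1, h2]
      simp only [hc, hm]
    · rw [List.getElem?_eq_none, List.getElem?_eq_none] <;>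
        simpa [length_flags] using hi

theorem marked_peakRule (γ : ColPerm G n) (i : Fin n) :
    Marked peakRule γ i ↔ IsPeak γ i := by
  by_cases h0 : (i : ℕ) = 0
  · refine iff_of_false ?_ ?_
    · rintro ⟨b, -, -, h⟩
      simp [leftNeighbour, h0, peakRule] at h
    · rintro ⟨a, b, ha, -⟩
      omega
  · have ha : ∀ a : Fin n, (a : ℕ) + 1 = i ↔ a = ⟨i - 1, by omega⟩ := fun a => by
      rw [Fin.ext_iff]
      change _ ↔ (a : ℕ) = i - 1
      omega
    simp only [IsPeak, ha, exists_and_left, exists_eq_left, Marked, leftNeighbour, h0, if_false,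
      getElem_word]
    split_ifs with h
    · simp only [peakRule, h, true_and]
    · simp [peakRule, h]

theorem gPeakComposition_eq_iff (γ γ' : ColPerm G n) :
    gPeakComposition γ = gPeakComposition γ' ↔
      col γ = col γ' ∧ ∀ i, IsPeak γ i ↔ IsPeak γ' i := by
  simp only [← marked_peakRule, ← flags_word_eq_iff]
  exact colouredComposition_eq_iff isLocal_peakSet _ _

theorem gDescentComposition_eq_iff (γ γ' : ColPerm G n) :
    gDescentComposition γ = gDescentComposition γ' ↔
      col γ = col γ' ∧ ∀ i, IsDescent γ i ↔ IsDescent γ' i := by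
  change _ ↔ col γ = col γ' ∧ ∀ i, Marked descentRule γ i ↔ Marked descentRule γ' i
  rw [← flags_word_eq_iff]
  exact colouredComposition_eq_iff isLocal_descentSet _ _

theorem gPeakComposition_eq_of_gDescentComposition_eq {γ γ' : ColPerm G n}
    (h : gDescentComposition γ = gDescentComposition γ') :
    gPeakComposition γ = gPeakComposition γ' := by
  rw [gDescentComposition_eq_iff] at h
  rw [gPeakComposition_eq_iff]
  refine ⟨h.1, fun i => ?_⟩
  simp only [isPeak_iff_isDescent, h.1, h.2]

theorem isGComposition_gDescentComposition (γ : ColPerm G n) :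
    IsGComposition n (gDescentComposition γ) := by
  have := isGComposition_colouredComposition isLocal_descentSet (word γ)
  rwa [length_word] at this

end ColouredPermutations

/-! ### Counting compatible signings -/

section Signs

variable {n : ℕ} {K : Type*} [LinearOrder K]

/-- The order on the positions of a word `w` in which positions are compared by the label `m`, then
by the sign `η`, then by the letter, where letters of negative sign are compared in reverse. -/
def SignedLT (m : Fin n → K) (η : Fin n → Bool) (w : Fin n → Fin n) (i j : Fin n) : Prop :=
  m i < m j ∨ m i = m j ∧ (η i < η j ∨ η i = η j ∧ if η i = true then w i < w j else w j < w i)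

/-- The signings compatible with a labelling `m` of a word `w`. -/
noncomputable def signings (m : Fin n → K) (w : Fin n → Fin n) : Finset (Fin n → Bool) :=
  open Classical in Finset.univ.filter fun η => ∀ i j, i < j → SignedLT m η w i j

theorem mem_signings {m : Fin n → K} {w : Fin n → Fin n} {η : Fin n → Bool} :
    η ∈ signings m w ↔ ∀ i j, i < j → SignedLT m η w i j := by
  simp [signings]

theorem SignedLT.trans {m : Fin n → K} {η : Fin n → Bool} {w : Fin n → Fin n} {i j k : Fin n}
    (h : SignedLT m η w i j) (h' : SignedLT m η w j k) : SignedLT m η w i k := by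
  rcases h with h | ⟨h, h1⟩
  · rcases h' with h' | ⟨h', -⟩
    · exact Or.inl (h.trans h')
    · exact Or.inl (h' ▸ h)
  · rcases h' with h' | ⟨h', h1'⟩
    · exact Or.inl (h ▸ h')
    · refine Or.inr ⟨h.trans h', ?_⟩
      cases hi : η i <;> cases hj : η j <;> cases hk : η k <;> simp_all [Bool.lt_iff] <;> omega

variable {m : Fin n → K} {w : Fin n → Fin n}

/-- The position `b` follows a position with the same label and a smaller letter. -/
def IsUp (m : Fin n → K) (w : Fin n → Fin n) (b : Fin n) : Prop :=
  ∃ a : Fin n, (a : ℕ) + 1 = b ∧ m a = m b ∧ w a < w b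

/-- The position `a` precedes a position with the same label and a smaller letter. -/
def IsDown (m : Fin n → K) (w : Fin n → Fin n) (a : Fin n) : Prop :=
  ∃ b : Fin n, (a : ℕ) + 1 = b ∧ m a = m b ∧ w b < w a

/-- By transitivity only consecutive positions matter. With equal labels, an ascent forces a
positive right end and a descent a negative left end. -/
theorem mem_signings_iff (hw : Function.Injective w) {η : Fin n → Bool} :
    η ∈ signings m w ↔ Monotone m ∧
      ∀ i, (IsUp m w i → η i = true) ∧ (IsDown m w i → η i = false) := by
  rw [mem_signings]
  constructor
  · intro h
    have hlt : ∀ {a b : Fin n}, (a : ℕ) + 1 = b → a < b := fun h => Fin.lt_def.2 (by omega)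
    refine ⟨fun i j hij => ?_, fun i => ⟨?_, ?_⟩⟩
    · rcases hij.eq_or_lt with rfl | hij
      · exact le_rfl
      · rcases h i j hij with h | h
        · exact h.le
        · exact h.1.le
    · rintro ⟨a, ha, hm, hl⟩
      rcases h a i (hlt ha) with h | ⟨-, h⟩
      · exact absurd hm h.ne
      · cases h1 : η i <;> cases h2 : η a <;> simp_all [Bool.lt_iff]
        exact lt_asymm h hl
    · rintro ⟨b, hb, hm, hl⟩
      rcases h i b (hlt hb) with h | ⟨-, h⟩
      · exact absurd hm h.ne
      · cases h1 : η i <;> cases h2 : η b <;> simp_all [Bool.lt_iff]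
        exact lt_asymm h hl
  · rintro ⟨hm, h⟩
    have step : ∀ a b : Fin n, (a : ℕ) + 1 = b → SignedLT m η w a b := by
      intro a b hab
      rcases (hm (show a ≤ b from Fin.le_def.2 (by omega))).lt_or_eq with h1 | h1
      · exact Or.inl h1
      · refine Or.inr ⟨h1, ?_⟩
        have hne : w a ≠ w b := fun h' => by
          have := hw h'
          subst this
          omega
        rcases lt_or_gt_of_ne hne with h2 | h2
        · have := (h b).1 ⟨a, hab, h1, h2⟩
          cases h3 : η a <;> simp_all
        · have := (h a).2 ⟨b, hab, h1, h2⟩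
          cases h3 : η b <;> simp_all
    have : ∀ (d : ℕ) (i j : Fin n), (i : ℕ) + d + 1 = j → SignedLT m η w i j := by
      intro d
      induction d with
      | zero => exact step
      | succ d ih =>
        intro i j hij
        exact (ih i ⟨i + d + 1, by omega⟩ rfl).trans (step _ _ (by simpa using by omega))
    intro i j hij
    exact this (j - i - 1) i j (by have := Fin.lt_def.1 hij; omega)

/-- The number of positions that have the same label as the preceding one. -/
noncomputable def numRepeats (m : Fin n → K) : ℕ :=
  open Classical in
  (Finset.univ.filter fun b : Fin n => ∃ a : Fin n, (a : ℕ) + 1 = b ∧ m a = m b).card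

/-- Each adjacent pair with equal labels is either an ascent, charged to its right end, or a
descent, charged to its left end. -/
theorem card_isUp_add_card_isDown [DecidablePred (IsUp m w)] [DecidablePred (IsDown m w)]
    (hw : Function.Injective w) :
    (Finset.univ.filter (IsUp m w)).card + (Finset.univ.filter (IsDown m w)).card =
      numRepeats m := by
  classical
  -- Descents are re-indexed by their right ends, so that both kinds are counted there.
  have h : (Finset.univ.filter (IsDown m w)).card = (Finset.univ.filter fun b : Fin n =>
      ∃ a : Fin n, (a : ℕ) + 1 = b ∧ m a = m b ∧ w b < w a).card := by
    refine Finset.card_bij' (fun a _ => if h : (a : ℕ) + 1 < n then ⟨a + 1, h⟩ else a)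
      (fun b _ => ⟨b - 1, by omega⟩) ?_ ?_ ?_ ?_
    · intro a ha
      obtain ⟨b, hb, h1, h2⟩ := (Finset.mem_filter.1 ha).2
      have : (⟨a + 1, by omega⟩ : Fin n) = b := Fin.ext hb
      rw [dif_pos (by omega), this]
      exact Finset.mem_filter.2 ⟨Finset.mem_univ _, a, hb, h1, h2⟩
    · intro b hb
      obtain ⟨a, ha, h1, h2⟩ := (Finset.mem_filter.1 hb).2
      have : (⟨b - 1, by omega⟩ : Fin n) = a := Fin.ext (by simp; omega)
      rw [this]
      exact Finset.mem_filter.2 ⟨Finset.mem_univ _, b, ha, h1, h2⟩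
    · intro a ha
      obtain ⟨b, hb, h1, h2⟩ := (Finset.mem_filter.1 ha).2
      simp [dif_pos (show (a : ℕ) + 1 < n by omega)]
    · intro b hb
      obtain ⟨a, ha, h1, h2⟩ := (Finset.mem_filter.1 hb).2
      rw [dif_pos (by simp; omega)]
      exact Fin.ext (by simp; omega)
  rw [h, numRepeats, ← Finset.card_union_of_disjoint]
  · congr 1
    ext b
    simp only [Finset.mem_union, Finset.mem_filter, Finset.mem_univ, true_and, IsUp]
    constructor
    · rintro (⟨a, h1, h2, -⟩ | ⟨a, h1, h2, -⟩) <;> exact ⟨a, h1, h2⟩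
    · rintro ⟨a, h1, h2⟩
      have hne : w a ≠ w b := fun h' => by
        have := hw h'
        subst this
        omega
      rcases lt_or_gt_of_ne hne with h3 | h3
      · exact Or.inl ⟨a, h1, h2, h3⟩
      · exact Or.inr ⟨a, h1, h2, h3⟩
  · rw [Finset.disjoint_filter]
    rintro b - ⟨a, h1, h2, h3⟩ ⟨a', h1', h2', h3'⟩
    obtain rfl : a = a' := Fin.ext (by omega)
    exact lt_asymm h3 h3'

theorem card_signings_eq_zero (hw : Function.Injective w)
    (h : ¬ (Monotone m ∧ ∀ i, ¬ (IsUp m w i ∧ IsDown m w i))) : (signings m w).card = 0 := by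
  rw [Finset.card_eq_zero, Finset.eq_empty_iff_forall_notMem]
  intro η hη
  rw [mem_signings_iff hw] at hη
  refine h ⟨hη.1, fun i hi => ?_⟩
  have h1 := (hη.2 i).1 hi.1
  rw [(hη.2 i).2 hi.2] at h1
  exact Bool.false_ne_true h1

/-- The constraints on the signs are independent, and exactly `numRepeats m` of the `n` signs are
forced. -/
theorem card_signings_mul (hw : Function.Injective w) (hm : Monotone m)
    (h : ∀ i, ¬ (IsUp m w i ∧ IsDown m w i)) :
    (signings m w).card * 2 ^ numRepeats m = 2 ^ n := by
  classical
  have h1 : signings m w = Fintype.piFinset fun i =>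
      Finset.univ.filter fun x => (IsUp m w i → x = true) ∧ (IsDown m w i → x = false) := by
    ext η
    simp [mem_signings_iff hw, hm]
  have h2 : ∀ i, (Finset.univ.filter fun x =>
      (IsUp m w i → x = true) ∧ (IsDown m w i → x = false)).card *
        ((if IsUp m w i then 2 else 1) * (if IsDown m w i then 2 else 1)) = 2 := by
    intro i
    have := h i
    by_cases hu : IsUp m w i <;> by_cases hd : IsDown m w i <;> simp_all [Finset.filter_eq']
  have h3 : 2 ^ numRepeats m =
      ∏ i, ((if IsUp m w i then 2 else 1) * (if IsDown m w i then 2 else 1)) := by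
    rw [← card_isUp_add_card_isDown hw, Finset.prod_mul_distrib, pow_add]
    simp [Finset.prod_ite]
  rw [h1, Fintype.card_piFinset, h3, ← Finset.prod_mul_distrib,
    Finset.prod_congr rfl fun i _ => h2 i]
  simp

theorem card_signings_congr {w' : Fin n → Fin n} (hw : Function.Injective w)
    (hw' : Function.Injective w')
    (h : ∀ i, IsUp m w i ∧ IsDown m w i ↔ IsUp m w' i ∧ IsDown m w' i) :
    (signings m w).card = (signings m w').card := by
  by_cases h1 : Monotone m ∧ ∀ i, ¬ (IsUp m w i ∧ IsDown m w i)
  · have h2 : Monotone m ∧ ∀ i, ¬ (IsUp m w' i ∧ IsDown m w' i) := by simpa only [h] using h1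
    have := (card_signings_mul hw h1.1 h1.2).trans (card_signings_mul hw' h2.1 h2.2).symm
    exact Nat.eq_of_mul_eq_mul_right (by positivity) this
  · rw [card_signings_eq_zero hw h1, card_signings_eq_zero hw' (by simpa only [h] using h1)]

theorem exists_card_signings (hm : Monotone m) : ∃ N : ℕ, N ≠ 0 ∧ ∀ w : Fin n → Fin n,
    Function.Injective w → (∀ i, ¬ (IsUp m w i ∧ IsDown m w i)) → (signings m w).card = N := by
  refine ⟨2 ^ n / 2 ^ numRepeats m, ?_, fun w hw h => ?_⟩
  -- The identity word has no descents, so it shows that the division is exact and the quotient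
  -- nonzero.
  · have := card_signings_mul (m := m) (w := id) Function.injective_id hm
      (by
        rintro i ⟨-, b, hb, -, h⟩
        exact absurd (Fin.lt_def.1 h) (by simp; omega))
    rw [← this, Nat.mul_div_cancel _ (by positivity)]
    intro h0
    rw [h0, zero_mul] at this
    exact absurd this.symm (by positivity)
  · rw [← card_signings_mul hw hm h, Nat.mul_div_cancel _ (by positivity)]

end Signs

/-! ### The product rule for signings -/

section Sorting

variable {n : ℕ} {K : Type*} [LinearOrder K] {m : Fin n → K} {η : Fin n → Bool}
  {w : Fin n → Fin n}

theorem SignedLT.irrefl (i : Fin n) : ¬ SignedLT m η w i i := by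
  simp [SignedLT]

/-- The sort key of a position in the order `SignedLT`. -/
def signedKey (m : Fin n → K) (η : Fin n → Bool) (w : Fin n → Fin n) (i : Fin n) :
    K ×ₗ Bool ×ₗ Fin n :=
  toLex (m i, toLex (η i, if η i = true then w i else (w i).rev))

theorem signedLT_iff_signedKey_lt {i j : Fin n} :
    SignedLT m η w i j ↔ signedKey m η w i < signedKey m η w j := by
  simp only [SignedLT, signedKey, Prod.Lex.toLex_lt_toLex]
  cases h : η i <;> cases h' : η j <;> simp

omit [LinearOrder K] in
theorem signedKey_injective (hw : Function.Injective w) :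
    Function.Injective (signedKey m η w) := by
  intro i j h
  simp only [signedKey, EmbeddingLike.apply_eq_iff_eq, Prod.mk.injEq] at h
  obtain ⟨-, h1, h2⟩ := h
  rw [h1] at h2
  split_ifs at h2
  · exact hw h2
  · exact hw (Fin.rev_injective h2)

theorem exists_perm_lt_iff_signedLT (m : Fin n → K) (η : Fin n → Bool)
    (hw : Function.Injective w) :
    ∃ b : Equiv.Perm (Fin n), ∀ i j, b i < b j ↔ SignedLT m η w i j := by
  refine ⟨(Tuple.sort (signedKey m η w))⁻¹, fun i j => ?_⟩
  have h : StrictMono (signedKey m η w ∘ Tuple.sort (signedKey m η w)) :=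
    (Tuple.monotone_sort _).strictMono_of_injective
      ((signedKey_injective hw).comp (Equiv.injective _))
  rw [signedLT_iff_signedKey_lt, ← h.lt_iff_lt]
  simp

theorem perm_eq_of_lt_iff {b c : Equiv.Perm (Fin n)} (h : ∀ i j, b i < b j ↔ c i < c j) :
    b = c := by
  have h1 : StrictMono (c ∘ b.symm) := fun i j hij => by
    simp only [Function.comp_apply]
    rw [← h]
    simpa using hij
  have h2 : c ∘ b.symm = id := (h1.range_inj strictMono_id).1 (by
    rw [(c.surjective.comp b.symm.surjective).range_eq, Function.surjective_id.range_eq])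
  ext i
  have := congrFun h2 (b i)
  simp at this
  rw [this]

/-- The signing gives one implication. Since the order of `b` is total and `SignedLT` is a strict
order, the converse follows. -/
theorem lt_iff_signedLT_of_mem_signings {b : Equiv.Perm (Fin n)}
    (h : η ∈ signings m (w ∘ b.symm)) (i j : Fin n) :
    b i < b j ↔ SignedLT (m ∘ b) (η ∘ b) w i j := by
  rw [mem_signings] at h
  have h' : ∀ i j, b i < b j → SignedLT (m ∘ b) (η ∘ b) w i j := fun i j hij => by
    simpa [SignedLT] using h _ _ hij
  refine ⟨h' i j, fun hs => ?_⟩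
  by_contra hn
  rcases (not_lt.1 hn).lt_or_eq with h1 | h1
  · exact SignedLT.irrefl _ (hs.trans (h' j i h1))
  · rw [b.injective h1] at hs
    exact SignedLT.irrefl _ hs

variable {N : ℕ}

/-- The labels obtained by refining the signed labels `(m', η')` by the labels `k`, in reverse
order where the sign is negative. -/
def refineLabels (m' : Fin n → Fin N) (η' : Fin n → Bool) (k : Fin n → Fin N) (i : Fin n) :
    Fin N ×ₗ Bool ×ₗ Fin N :=
  toLex (m' i, toLex (η' i, if η' i = true then k i else (k i).rev))

/-- Where `η'` is negative the order of `b` is reversed, which reverses the labels `k` and flips the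
signs `η`. Hence the new sign `η i == η' i` is the product of the two. -/
theorem signedLT_refineLabels_iff {m' k : Fin n → Fin N} {η' : Fin n → Bool}
    {b : Equiv.Perm (Fin n)} (h : ∀ i j, b i < b j ↔ SignedLT k η w i j) (i j : Fin n) :
    SignedLT m' η' b i j ↔
      SignedLT (refineLabels m' η' k) (fun i => η i == η' i) w i j := by
  simp only [SignedLT, refineLabels, Prod.Lex.toLex_lt_toLex, h, EmbeddingLike.apply_eq_iff_eq,
    Prod.mk.injEq]
  rcases Bool.eq_false_or_eq_true (η' i) with hi | hi <;>
  rcases Bool.eq_false_or_eq_true (η' j) with hj | hj <;>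
  rcases Bool.eq_false_or_eq_true (η i) with hi' | hi' <;>
  rcases Bool.eq_false_or_eq_true (η j) with hj' | hj' <;>
    simp [hi, hj, hi', hj', eq_comm (a := k j)] <;> tauto

/-- A bijection: `(b, e, e')` goes to the labels `m ∘ b`, the signs `e'` and the product of `e ∘ b`
with `e'`. Conversely, labels and signs recover `b` as the permutation that sorts the positions of
`g` by `SignedLT`. -/
theorem sum_card_signings_mul (m m' : Fin n → Fin N) (hm : Monotone m)
    (C : (Fin n → Fin N) → Prop) [DecidablePred C]
    [DecidablePred fun p : (Fin n → Fin N) × (Fin n → Bool) =>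
      C p.1 ∧ ∃ σ : Equiv.Perm (Fin n), p.1 = m ∘ ⇑σ] (g : Equiv.Perm (Fin n)) :
    ∑ b ∈ Finset.univ.filter fun b : Equiv.Perm (Fin n) => C (m ∘ b),
      (signings m (g ∘ b.symm)).card * (signings m' ⇑b).card =
    ∑ p : (Fin n → Fin N) × (Fin n → Bool) with C p.1 ∧ ∃ σ : Equiv.Perm (Fin n), p.1 = m ∘ ⇑σ,
      (signings (refineLabels m' p.2 p.1) g).card := by
  simp only [← Finset.card_product]
  rw [← Finset.card_sigma, ← Finset.card_sigma]
  refine Finset.card_bij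
    (fun x _ => ⟨(m ∘ ⇑x.1, x.2.2), fun i => x.2.1 (x.1 i) == x.2.2 i⟩) ?_ ?_ ?_
  · rintro ⟨b, e, e'⟩ hx
    simp only [Finset.mem_sigma, Finset.mem_filter, Finset.mem_univ, true_and,
      Finset.mem_product] at hx ⊢
    obtain ⟨hC, he, he'⟩ := hx
    refine ⟨⟨hC, b, rfl⟩, ?_⟩
    rw [mem_signings] at he' ⊢
    intro i j hij
    exact (signedLT_refineLabels_iff (lt_iff_signedLT_of_mem_signings he) i j).1 (he' i j hij)
  · rintro ⟨b, e, e'⟩ hx ⟨c, f, f'⟩ hy h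
    simp only [Finset.mem_sigma, Finset.mem_filter, Finset.mem_univ, true_and,
      Finset.mem_product] at hx hy
    simp only [Sigma.mk.injEq, Prod.mk.injEq, heq_eq_eq] at h
    obtain ⟨⟨h1, rfl⟩, h2⟩ := h
    have h3 : e ∘ ⇑b = f ∘ ⇑c := by
      funext i
      have := congrFun h2 i
      simp only [Function.comp_apply] at this ⊢
      revert this
      cases e (b i) <;> cases f (c i) <;> cases e' i <;> simp
    obtain rfl : b = c := perm_eq_of_lt_iff fun i j => by
      refine (lt_iff_signedLT_of_mem_signings hx.2.1 i j).trans ?_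
      rw [h1, h3]
      exact (lt_iff_signedLT_of_mem_signings hy.2.1 i j).symm
    rw [b.surjective.injective_comp_right h3]
  · rintro ⟨⟨k, e'⟩, η⟩ hy
    simp only [Finset.mem_sigma, Finset.mem_filter, Finset.mem_univ, true_and] at hy
    obtain ⟨⟨hC, σ, hσ⟩, hη⟩ := hy
    -- Multiplying by `e'` again undoes the product of signs.
    set e : Fin n → Bool := fun i => η i == e' i with he
    have hee : (fun i => e i == e' i) = η := by
      funext i
      simp only [he]
      cases η i <;> cases e' i <;> rfl
    obtain ⟨b, hb⟩ := exists_perm_lt_iff_signedLT k e g.injective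
    have hmono : Monotone (m ∘ (σ * b⁻¹ : Equiv.Perm (Fin n))) := by
      intro i j hij
      rcases hij.lt_or_eq with hij | rfl
      · have : b (b⁻¹ i) < b (b⁻¹ j) := by simpa using hij
        have hk : ∀ i, m (σ i) = k i := fun i => (congrFun hσ i).symm
        simp only [Function.comp_apply, Equiv.Perm.mul_apply, hk]
        rcases (hb _ _).1 this with h | h
        · exact h.le
        · exact h.1.le
      · exact le_rfl
    have hk : m ∘ ⇑b = k := by
      -- `k` sorted by `b` and `m` itself are both monotone rearrangements of `m`, hence equal.
      have h1 := Tuple.unique_monotone (σ := σ * b⁻¹) (τ := 1) hmono (by simpa using hm)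
      rw [hσ]
      funext i
      simpa using (congrFun h1 (b i)).symm
    refine ⟨⟨b, e ∘ b.symm, e'⟩, ?_, ?_⟩
    · simp only [Finset.mem_sigma, Finset.mem_filter, Finset.mem_univ, true_and,
        Finset.mem_product, hk]
      refine ⟨hC, ?_, ?_⟩
      · rw [mem_signings]
        intro i j hij
        have : b (b.symm i) < b (b.symm j) := by simpa using hij
        have := (hb _ _).1 this
        rw [← hk] at this
        simpa [SignedLT] using this
      · rw [mem_signings] at hη ⊢
        intro i j hij
        rw [signedLT_refineLabels_iff hb, hee]
        exact hη i j hij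
    · simp [hk, hee]

end Sorting

/-! ### Labellings with prescribed cuts -/

section Labellings

variable {n : ℕ}

/-- Fibres of a monotone map are intervals, so comparing neighbours suffices. -/
theorem eq_of_label_eq {K X : Type*} [LinearOrder K] {m : Fin n → K} (hm : Monotone m)
    {f : Fin n → X} (h : ∀ a b : Fin n, (a : ℕ) + 1 = b → m a = m b → f a = f b) (i j : Fin n)
    (hij : m i = m j) : f i = f j := by
  have key : ∀ (d : ℕ) (i j : Fin n), (i : ℕ) + d = j → m i = m j → f i = f j := by
    intro d
    induction d with
    | zero => intro i j hd _; rw [Fin.ext (show (i : ℕ) = j from hd)]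
    | succ d ih =>
      intro i j hd hmij
      have hk : (i : ℕ) + d < n := by omega
      have h1 : m i ≤ m ⟨i + d, hk⟩ := hm (Fin.le_def.2 (by simp))
      have h2 : m ⟨i + d, hk⟩ ≤ m j := hm (Fin.le_def.2 (by simp; omega))
      have h3 : m i = m ⟨i + d, hk⟩ := le_antisymm h1 (h2.trans hmij.ge)
      exact (ih i ⟨i + d, hk⟩ rfl h3).trans (h _ j (by simp; omega) (h3.symm.trans hmij))
  rcases le_total i j with hle | hle
  · exact key (j - i) i j (by have := Fin.le_def.1 hle; omega) hij
  · exact (key (i - j) j i (by have := Fin.le_def.1 hle; omega) hij.symm).symm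

theorem exists_monotone_label (cut : Fin n → Prop) :
    ∃ m : Fin n → Fin (n + 1), Monotone m ∧
      ∀ a b : Fin n, (a : ℕ) + 1 = b → (m a = m b ↔ ¬ cut b) := by
  classical
  -- The label counts the cuts so far, at most `n`; hence the target `Fin (n + 1)`.
  refine ⟨fun i => ⟨(Finset.univ.filter fun j => j ≤ i ∧ cut j).card,
    Nat.lt_succ_of_le ((Finset.card_le_univ _).trans (by simp))⟩, ?_, ?_⟩
  · intro i j hij
    change (Finset.univ.filter fun k => k ≤ i ∧ cut k).card ≤
      (Finset.univ.filter fun k => k ≤ j ∧ cut k).card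
    refine Finset.card_le_card fun k hk => ?_
    rw [Finset.mem_filter] at hk ⊢
    exact ⟨hk.1, hk.2.1.trans hij, hk.2.2⟩
  · intro a b hab
    have hle : ∀ j : Fin n, j ≤ b ↔ j ≤ a ∨ j = b := fun j => by
      rw [Fin.le_def, Fin.le_def, Fin.ext_iff]; omega
    have hba : ¬ b ≤ a := by rw [Fin.le_def]; omega
    rw [Fin.ext_iff]
    change (Finset.univ.filter fun j => j ≤ a ∧ cut j).card =
      (Finset.univ.filter fun j => j ≤ b ∧ cut j).card ↔ _
    by_cases hc : cut b
    · have : (Finset.univ.filter fun j => j ≤ b ∧ cut j) =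
          insert b (Finset.univ.filter fun j => j ≤ a ∧ cut j) := by
        ext j
        simp only [hle, Finset.mem_filter, Finset.mem_univ, true_and, Finset.mem_insert]
        constructor
        · rintro ⟨h | h, h'⟩
          · exact Or.inr ⟨h, h'⟩
          · exact Or.inl h
        · rintro (rfl | h)
          · exact ⟨Or.inr rfl, hc⟩
          · exact ⟨Or.inl h.1, h.2⟩
      rw [this, Finset.card_insert_of_notMem (by simp [hba])]
      simp [hc]
    · have : (Finset.univ.filter fun j => j ≤ b ∧ cut j) =
          (Finset.univ.filter fun j => j ≤ a ∧ cut j) := by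
        ext j
        simp only [hle, Finset.mem_filter, Finset.mem_univ, true_and]
        constructor
        · rintro ⟨h | rfl, h'⟩
          · exact ⟨h, h'⟩
          · exact absurd h' hc
        · exact fun h => ⟨Or.inl h.1, h.2⟩
      rw [this]
      simp [hc]

/-- Move each element of `P` outside `R` one step up. This lands in `R`, is injective because `P`
has no two consecutive elements, and raises the sum if anything moves. If nothing moves, `P ⊆ R`,
and a proper inclusion is strict on sums as `0 ∉ R`. -/
theorem eq_or_sum_lt_sum {P R : Finset ℕ} (hP : ∀ i ∈ P, i + 1 ∉ P) (hR : 0 ∉ R)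
    (h : ∀ i ∈ P, i ∈ R ∨ i + 1 ∈ R) : P = R ∨ ∑ i ∈ P, i < ∑ i ∈ R, i := by
  classical
  by_cases hsub : P ⊆ R
  · rcases hsub.eq_or_ssubset with h1 | h1
    · exact Or.inl h1
    · obtain ⟨i, hi, hi'⟩ := Finset.exists_of_ssubset h1
      exact Or.inr (Finset.sum_lt_sum_of_subset hsub hi hi'
        (Nat.pos_of_ne_zero fun h0 => hR (h0 ▸ hi)) fun _ _ _ => Nat.zero_le _)
  · right
    obtain ⟨i, hi, hi'⟩ := Finset.not_subset.1 hsub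
    let f : ℕ → ℕ := fun i => if i ∈ R then i else i + 1
    have hle : ∀ i, i ≤ f i := fun i => by simp only [f]; split_ifs <;> omega
    have hinj : Set.InjOn f P := by
      intro a ha b hb hab
      have ha' := hP a ha
      have hb' := hP b hb
      simp only [f] at hab
      split_ifs at hab
      · exact hab
      · exact absurd (hab ▸ ha) hb'
      · exact absurd (hab ▸ hb) ha'
      · omega
    calc ∑ i ∈ P, i < ∑ i ∈ P, f i :=
          Finset.sum_lt_sum (fun i _ => hle i) ⟨i, hi, by simp [f, hi']⟩
      _ = ∑ i ∈ P.image f, i := by rw [Finset.sum_image hinj]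
      _ ≤ ∑ i ∈ R, i := Finset.sum_le_sum_of_subset (by
          intro j hj
          obtain ⟨a, ha, rfl⟩ := Finset.mem_image.1 hj
          simp only [f]
          split_ifs with h'
          · exact h'
          · exact (h a ha).resolve_left h')

end Labellings

/-! ### A labelling adapted to a given peak set -/

section ColouredPermutations

variable {G : Type*} [CommGroup G] {n : ℕ}

theorem col_mul (α β : ColPerm G n) (i : Fin n) :
    col (α * β) i = col α (β.right i) * col β i := by
  change α.left (α.right (β.right i)) * β.left (α.right⁻¹ (α.right (β.right i))) = _
  simp [col]

/-- The coloured permutation with colours `χ` and underlying permutation `b`. -/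
def ofCol (χ : Fin n → G) (b : Equiv.Perm (Fin n)) : ColPerm G n :=
  ⟨fun a => χ (b.symm a), b⟩

@[simp] theorem col_ofCol (χ : Fin n → G) (b : Equiv.Perm (Fin n)) : col (ofCol χ b) = χ := by
  funext i
  simp [col, ofCol]

@[simp] theorem right_ofCol (χ : Fin n → G) (b : Equiv.Perm (Fin n)) :
    (ofCol χ b).right = b := rfl

theorem ofCol_col (α : ColPerm G n) : ofCol (col α) α.right = α := by
  refine SemidirectProduct.ext (funext fun a => ?_) rfl
  simp [ofCol, col]

/-- Shows that the obstruction to signings depends on the word only through its peaks, provided that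
blocks are monochromatic. -/
theorem isUp_and_isDown_iff {K : Type*} {m : Fin n → K} {γ : ColPerm G n}
    (h : ∀ a b, m a = m b → col γ a = col γ b) (i : Fin n) :
    IsUp m γ.right i ∧ IsDown m γ.right i ↔ IsPeak γ i ∧
      ∃ a b : Fin n, (a : ℕ) + 1 = i ∧ (i : ℕ) + 1 = b ∧ m a = m i ∧ m i = m b := by
  constructor
  · rintro ⟨⟨a, ha, h1, h2⟩, b, hb, h3, h4⟩
    exact ⟨⟨a, b, ha, hb, h _ _ h1, h _ _ h3, h2, h4⟩, a, b, ha, hb, h1, h3⟩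
  · rintro ⟨⟨a, b, ha, hb, -, -, h2, h4⟩, a', b', ha', hb', h1, h3⟩
    obtain rfl : a = a' := Fin.ext (by omega)
    obtain rfl : b = b' := Fin.ext (by omega)
    exact ⟨⟨a, ha, h1, h2⟩, b, hb, h3, h4⟩

open Classical in
/-- The set of positions of the peaks of a coloured permutation. -/
noncomputable def peaks (γ : ColPerm G n) : Finset ℕ :=
  (Finset.univ.filter (IsPeak γ)).image Fin.val

theorem mem_peaks {γ : ColPerm G n} {i : ℕ} :
    i ∈ peaks γ ↔ ∃ j : Fin n, IsPeak γ j ∧ (j : ℕ) = i := by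
  simp [peaks]

theorem zero_notMem_peaks (γ : ColPerm G n) : 0 ∉ peaks γ := by
  rw [mem_peaks]
  rintro ⟨j, ⟨a, b, ha, -⟩, hj⟩
  omega

theorem succ_notMem_peaks (γ : ColPerm G n) : ∀ i ∈ peaks γ, i + 1 ∉ peaks γ := by
  intro i hi hi'
  rw [mem_peaks] at hi hi'
  obtain ⟨j, ⟨a, b, ha, hb, -, -, -, h⟩, rfl⟩ := hi
  obtain ⟨k, ⟨c, d, hc, hd, -, -, h', -⟩, hk⟩ := hi'
  obtain rfl : b = k := Fin.ext (by omega)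
  obtain rfl : c = j := Fin.ext (by omega)
  exact lt_asymm h h'

/-- Cut before each peak of `α` and at each colour change. A peak `i` of `β` that is not interior to
a block has a cut just before or just after it. No colour changes there, so `i` or `i + 1` is a peak
of `α`, and `eq_or_sum_lt_sum` applies. -/
theorem exists_label (α : ColPerm G n) :
    ∃ m : Fin n → Fin (n + 1), Monotone m ∧ (∀ i j, m i = m j → col α i = col α j) ∧
      (∀ i, ¬ (IsUp m α.right i ∧ IsDown m α.right i)) ∧
      ∀ β : ColPerm G n, col β = col α → (∀ i, ¬ (IsUp m β.right i ∧ IsDown m β.right i)) →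
        (∀ i, IsPeak β i ↔ IsPeak α i) ∨ ∑ i ∈ peaks β, i < ∑ i ∈ peaks α, i := by
  obtain ⟨m, hm, hcut⟩ := exists_monotone_label fun b : Fin n =>
    IsPeak α b ∨ ∃ a : Fin n, (a : ℕ) + 1 = b ∧ col α a ≠ col α b
  have hcol : ∀ i j, m i = m j → col α i = col α j := by
    refine eq_of_label_eq hm fun a b hab h => ?_
    by_contra hne
    exact (hcut a b hab).1 h (Or.inr ⟨a, hab, hne⟩)
  refine ⟨m, hm, hcol, fun i => ?_, fun β hβ h => ?_⟩
  · rw [isUp_and_isDown_iff hcol]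
    rintro ⟨hp, a, b, ha, hb, h1, h2⟩
    exact (hcut a i ha).1 h1 (Or.inl hp)
  · have hP : ∀ i ∈ peaks β, i ∈ peaks α ∨ i + 1 ∈ peaks α := by
      intro i hi
      obtain ⟨j, hj, rfl⟩ := mem_peaks.1 hi
      have h' := h j
      rw [isUp_and_isDown_iff (by rwa [hβ])] at h'
      obtain ⟨a, b, ha, hb, h1, h2, -⟩ := id hj
      rw [hβ] at h1 h2
      by_contra hn
      rw [not_or, mem_peaks, mem_peaks] at hn
      refine h' ⟨hj, a, b, ha, hb, (hcut a j ha).2 ?_, (hcut j b hb).2 ?_⟩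
      · rintro (h3 | ⟨c, hc, h3⟩)
        · exact hn.1 ⟨j, h3, rfl⟩
        · obtain rfl : a = c := Fin.ext (by omega)
          exact h3 h1
      · rintro (h3 | ⟨c, hc, h3⟩)
        · exact hn.2 ⟨b, h3, hb.symm⟩
        · obtain rfl : j = c := Fin.ext (by omega)
          exact h3 h2
    rcases eq_or_sum_lt_sum (succ_notMem_peaks β) (zero_notMem_peaks α) hP with h1 | h1
    · refine Or.inl fun i => ?_
      have : ∀ γ : ColPerm G n, IsPeak γ i ↔ (i : ℕ) ∈ peaks γ := fun γ => by
        rw [mem_peaks]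
        exact ⟨fun h => ⟨i, h, rfl⟩, fun ⟨j, h, hj⟩ => Fin.ext hj ▸ h⟩
      rw [this, this, h1]
    · exact Or.inr h1

end ColouredPermutations

/-! ### The peak module and its multiplication -/

section PeakModule

variable {G : Type*} [CommGroup G] [Fintype G] [DecidableEq G] {n : ℕ}

theorem coeff_sum_smul_of (F : ColPerm G n → ℤ) (γ : ColPerm G n) :
    (∑ α, F α • MonoidAlgebra.of ℤ (ColPerm G n) α).coeff γ = F γ := by
  classical
  rw [MonoidAlgebra.coeff_sum, Finsupp.finsetSum_apply]
  simp [MonoidAlgebra.of_apply, Finsupp.single_apply]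

theorem sum_coeff_smul_of (x : MonoidAlgebra ℤ (ColPerm G n)) :
    ∑ α, x.coeff α • MonoidAlgebra.of ℤ (ColPerm G n) α = x := by
  apply MonoidAlgebra.coeff_injective
  ext γ
  rw [coeff_sum_smul_of]

theorem coeff_peakElement (c : List (ℕ × G)) (γ : ColPerm G n) :
    (peakElement n c).coeff γ = if gPeakComposition γ = c then 1 else 0 := by
  rw [← coeff_sum_smul_of (fun γ => if gPeakComposition γ = c then 1 else 0), peakElement,
    Finset.sum_filter]
  simp only [ite_smul, one_smul, zero_smul]

theorem sum_of_mem_span_peakElement (N : Submodule ℤ (MonoidAlgebra ℤ (ColPerm G n)))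
    (F : ColPerm G n → ℤ) (hF : ∀ α β, gPeakComposition α = gPeakComposition β → F α = F β)
    (hN : ∀ α, F α ≠ 0 → peakElement n (gPeakComposition α) ∈ N) :
    ∑ α, F α • MonoidAlgebra.of ℤ (ColPerm G n) α ∈ N := by
  rw [← Finset.sum_fiberwise_of_maps_to (s := Finset.univ)
    (t := Finset.univ.image (gPeakComposition : ColPerm G n → _)) (g := gPeakComposition)
    (fun α _ => Finset.mem_image_of_mem _ (Finset.mem_univ α))]
  refine Submodule.sum_mem _ fun c hc => ?_
  obtain ⟨α, -, rfl⟩ := Finset.mem_image.1 hc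
  rw [Finset.sum_congr rfl fun β hβ => by rw [hF β α (Finset.mem_filter.1 hβ).2],
    ← Finset.smul_sum]
  by_cases h0 : F α = 0
  · rw [h0, zero_smul]
    exact Submodule.zero_mem _
  · exact Submodule.smul_mem _ _ (hN α h0)

theorem mem_peakModule_iff {x : MonoidAlgebra ℤ (ColPerm G n)} :
    x ∈ peakModule G n ↔
      ∀ α β, gPeakComposition α = gPeakComposition β → x.coeff α = x.coeff β := by
  constructor
  · intro hx α β h
    refine Submodule.span_induction ?_ ?_ ?_ ?_ hx
    · rintro _ ⟨c, -, rfl⟩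
      rw [coeff_peakElement, coeff_peakElement, h]
    · rfl
    · intro x y _ _ hx hy
      rw [MonoidAlgebra.coeff_add, Finsupp.add_apply, Finsupp.add_apply, hx, hy]
    · intro a x _ hx
      rw [MonoidAlgebra.coeff_smul_apply, MonoidAlgebra.coeff_smul_apply, hx]
  · intro h
    rw [← sum_coeff_smul_of x]
    exact sum_of_mem_span_peakElement _ _ h
      fun α _ => Submodule.subset_span ⟨_, Set.mem_range_self α, rfl⟩

theorem linearIndependent_peakElement :
    LinearIndependent ℤ (fun c : gPeakCompositions G n => peakElement n c.1) := by
  rw [linearIndependent_iff']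
  rintro s g hg ⟨c, α, rfl⟩ hc
  have := congrArg (fun x : MonoidAlgebra ℤ (ColPerm G n) => x.coeff α) hg
  simp only [MonoidAlgebra.coeff_sum, Finsupp.finsetSum_apply, MonoidAlgebra.coeff_smul_apply,
    coeff_peakElement, MonoidAlgebra.coeff_zero, Finsupp.coe_zero, Pi.zero_apply, smul_eq_mul,
    mul_ite, mul_one, mul_zero] at this
  rw [Finset.sum_eq_single_of_mem _ hc] at this
  · simpa using this
  · rintro ⟨d, hd⟩ - hne
    rw [if_neg fun h => hne (Subtype.ext h.symm)]

theorem peakModule_le_mantaciReutenauer : peakModule G n ≤ mantaciReutenauer G n := by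
  refine Submodule.span_le.2 ?_
  rintro _ ⟨c, -, rfl⟩
  rw [peakElement, ← Finset.sum_fiberwise_of_maps_to
    (t := Finset.univ.image (gDescentComposition : ColPerm G n → _)) (g := gDescentComposition)
    (fun α _ => Finset.mem_image_of_mem _ (Finset.mem_univ α))]
  refine Submodule.sum_mem _ fun d hd => ?_
  obtain ⟨α, -, rfl⟩ := Finset.mem_image.1 hd
  have hα : descentElement n (gDescentComposition α) ∈ mantaciReutenauer G n :=
    Submodule.subset_span ⟨_, isGComposition_gDescentComposition α, rfl⟩
  rw [Finset.filter_filter]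
  by_cases h : gPeakComposition α = c
  · rw [descentElement] at hα
    convert hα using 2
    ext β
    simp only [Finset.mem_filter, Finset.mem_univ, true_and, and_iff_right_iff_imp]
    exact fun h' => (gPeakComposition_eq_of_gDescentComposition_eq h').trans h
  · rw [Finset.filter_false_of_mem, Finset.sum_empty]
    · exact Submodule.zero_mem _
    · rintro β - ⟨h1, h2⟩
      exact h ((gPeakComposition_eq_of_gDescentComposition_eq h2).symm.trans h1)

theorem one_notMem_peakModule (hn : 2 ≤ n) :
    (1 : MonoidAlgebra ℤ (ColPerm G n)) ∉ peakModule G n := by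
  intro h
  -- The word `2 1 3 ⋯ n` has no interior peak, so it shares its class with the identity.
  let σ : Equiv.Perm (Fin n) := Equiv.swap ⟨0, by omega⟩ ⟨1, by omega⟩
  have hσ : ofCol 1 σ ≠ (1 : ColPerm G n) := fun h' => by
    have h1 := congrArg (fun α : ColPerm G n => α.right ⟨0, by omega⟩) h'
    simp [σ] at h1
  have h1 := mem_peakModule_iff.1 h (ofCol 1 σ) 1 ?_
  · rw [MonoidAlgebra.one_def, MonoidAlgebra.coeff_single, Finsupp.single_eq_same,
      Finsupp.single_eq_of_ne hσ] at h1
    exact zero_ne_one h1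
  · rw [gPeakComposition_eq_iff]
    refine ⟨by rw [col_ofCol]; rfl, fun i => iff_of_false ?_ ?_⟩
    · rintro ⟨a, b, ha, hb, -, -, -, h2⟩
      have hb' : σ b = b := Equiv.swap_apply_of_ne_of_ne (by rw [ne_eq, Fin.ext_iff]; simp; omega)
        (by rw [ne_eq, Fin.ext_iff]; simp; omega)
      rw [right_ofCol, hb'] at h2
      by_cases hi : (i : ℕ) = 1
      · have : σ i = ⟨0, by omega⟩ := by
          rw [show i = ⟨1, by omega⟩ from Fin.ext hi]
          exact Equiv.swap_apply_right _ _
        rw [this] at h2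
        exact absurd (Fin.lt_def.1 h2) (by simp)
      · have hi' : σ i = i := Equiv.swap_apply_of_ne_of_ne
          (by rw [ne_eq, Fin.ext_iff]; simp; omega) (by rw [ne_eq, Fin.ext_iff]; simp; omega)
        rw [hi'] at h2
        exact absurd (Fin.lt_def.1 h2) (by omega)
    · rintro ⟨a, b, ha, hb, -, -, -, h2⟩
      exact absurd (Fin.lt_def.1 h2) (by simp; omega)

/-- The sum of all coloured permutations with colours `χ`, each as often as its word has signings
compatible with the labels `m`. -/
noncomputable def signedElement (m : Fin n → Fin (n + 1)) (χ : Fin n → G) :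
    MonoidAlgebra ℤ (ColPerm G n) :=
  ∑ α, (if col α = χ then ((signings m α.right).card : ℤ) else 0) •
    MonoidAlgebra.of ℤ (ColPerm G n) α

theorem sum_col_eq (χ : Fin n → G) (f : ColPerm G n → ℤ) :
    ∑ β with col β = χ, f β = ∑ b, f (ofCol χ b) := by
  refine Finset.sum_bij' (fun β _ => β.right) (fun b _ => ofCol χ b) ?_ ?_ ?_ ?_ ?_
  · simp
  · simp
  · intro β hβ
    rw [← (Finset.mem_filter.1 hβ).2, ofCol_col]
  · simp
  · intro β hβ
    rw [← (Finset.mem_filter.1 hβ).2, ofCol_col]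

theorem coeff_signedElement_mul (m m' : Fin n → Fin (n + 1)) (hm : Monotone m)
    (g g' : Fin (n + 1) → G) (γ : ColPerm G n)
    [DecidablePred fun p : (Fin n → Fin (n + 1)) × (Fin n → Bool) =>
      (∀ i, col γ i = g (p.1 i) * g' (m' i)) ∧ ∃ σ : Equiv.Perm (Fin n), p.1 = m ∘ ⇑σ] :
    (signedElement m (g ∘ m) * signedElement m' (g' ∘ m')).coeff γ =
      ∑ p : (Fin n → Fin (n + 1)) × (Fin n → Bool) with
        (∀ i, col γ i = g (p.1 i) * g' (m' i)) ∧ ∃ σ : Equiv.Perm (Fin n), p.1 = m ∘ ⇑σ,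
        ((signings (refineLabels m' p.2 p.1) γ.right).card : ℤ) := by
  classical
  rw [← Nat.cast_sum, ← sum_card_signings_mul m m' hm (fun k => ∀ i, col γ i = g (k i) * g' (m' i)),
    MonoidAlgebra.coeff_mul_apply_right, Finsupp.sum_fintype _ _ (by simp)]
  simp only [signedElement, coeff_sum_smul_of, mul_ite, mul_zero]
  rw [← Finset.sum_filter, sum_col_eq, Nat.cast_sum, Finset.sum_filter]
  refine Finset.sum_congr rfl fun b _ => ?_
  -- With right factor `ofCol (g' ∘ m') b`, the left factor is determined by `γ`; its colour
  -- condition becomes one on the labels `m ∘ b`.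
  have h : col (γ * (ofCol (g' ∘ m') b)⁻¹) = g ∘ m ↔
      ∀ i, col γ i = g ((m ∘ b) i) * g' (m' i) := by
    have h1 : ∀ i, col γ i = col (γ * (ofCol (g' ∘ m') b)⁻¹) (b i) * g' (m' i) := fun i => by
      conv_lhs => rw [← inv_mul_cancel_right γ (ofCol (g' ∘ m') b), col_mul, col_ofCol]
      rfl
    constructor
    · intro h i
      rw [h1, h]
      rfl
    · intro h
      funext j
      have h2 := h1 (b.symm j)
      rw [h, Function.comp_apply, Equiv.apply_symm_apply] at h2
      exact (mul_right_cancel h2).symm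
  simp only [h, ite_mul, zero_mul, Nat.cast_mul]
  rfl

theorem refineLabels_eq {N : ℕ} {m' k : Fin n → Fin N} {η' : Fin n → Bool} {i j : Fin n}
    (h : refineLabels m' η' k i = refineLabels m' η' k j) : m' i = m' j ∧ k i = k j := by
  simp only [refineLabels, EmbeddingLike.apply_eq_iff_eq, Prod.mk.injEq] at h
  obtain ⟨h1, h2, h3⟩ := h
  rw [h2] at h3
  split_ifs at h3
  · exact ⟨h1, h3⟩
  · exact ⟨h1, Fin.rev_injective h3⟩

/-- The colour condition makes the refined blocks monochromatic, so every summand depends only on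
the colours and peaks of the product. -/
theorem signedElement_mul_mem (m m' : Fin n → Fin (n + 1)) (hm : Monotone m)
    (g g' : Fin (n + 1) → G) :
    signedElement m (g ∘ m) * signedElement m' (g' ∘ m') ∈ peakModule G n := by
  classical
  rw [mem_peakModule_iff]
  intro γ δ h
  rw [gPeakComposition_eq_iff] at h
  rw [coeff_signedElement_mul m m' hm, coeff_signedElement_mul m m' hm]
  simp only [h.1]
  refine Finset.sum_congr rfl fun p hp => ?_
  have hC := (Finset.mem_filter.1 hp).2.1
  have hδ : ∀ a b, refineLabels m' p.2 p.1 a = refineLabels m' p.2 p.1 b → col δ a = col δ b := by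
    intro a b hab
    rw [hC, hC, (refineLabels_eq hab).1, (refineLabels_eq hab).2]
  rw [card_signings_congr γ.right.injective δ.right.injective fun i => ?_]
  rw [isUp_and_isDown_iff hδ, isUp_and_isDown_iff (by rwa [h.1]), h.2]

/-- Strong induction on the sum of the peak positions: the signed element of an adapted labelling is
a nonzero multiple of the required peak element plus peak elements of smaller sum. -/
theorem peakModule_le_of_signedElement_mem (N : Submodule ℤ (MonoidAlgebra ℤ (ColPerm G n)))
    (hsat : ∀ (k : ℤ) x, k ≠ 0 → k • x ∈ N → x ∈ N)
    (hN : ∀ (m : Fin n → Fin (n + 1)) (g : Fin (n + 1) → G), Monotone m →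
      signedElement m (g ∘ m) ∈ N) : peakModule G n ≤ N := by
  classical
  have key : ∀ (s : ℕ) (α : ColPerm G n), ∑ i ∈ peaks α, i = s →
      peakElement n (gPeakComposition α) ∈ N := by
    intro s
    induction s using Nat.strong_induction_on with
    | _ s ih =>
      intro α hs
      obtain ⟨m, hm, hcol, hα, hlt⟩ := exists_label α
      obtain ⟨g, hg⟩ := (Function.factorsThrough_iff (f := m) (col α)).1 fun i j h => hcol i j h
      obtain ⟨M, hM, hcard⟩ := exists_card_signings hm
      -- The signed element divided by its common nonzero coefficient `M`.
      let F : ColPerm G n → ℤ := fun β =>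
        if col β = col α ∧ ∀ i, ¬ (IsUp m β.right i ∧ IsDown m β.right i) then 1 else 0
      have hF : ∑ β, F β • MonoidAlgebra.of ℤ (ColPerm G n) β ∈ N := by
        refine hsat M _ (by exact_mod_cast hM) ?_
        convert hN m g hm using 1
        rw [signedElement, Finset.smul_sum]
        refine Finset.sum_congr rfl fun β _ => ?_
        rw [smul_smul, ← hg]
        congr 1
        simp only [F]
        by_cases h1 : col β = col α
        · by_cases h2 : ∀ i, ¬ (IsUp m β.right i ∧ IsDown m β.right i)
          · rw [if_pos ⟨h1, h2⟩, if_pos h1, hcard _ β.right.injective h2, mul_one]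
          · rw [if_neg (fun h => h2 h.2), if_pos h1,
              card_signings_eq_zero β.right.injective (fun h => h2 h.2), mul_zero, Nat.cast_zero]
        · rw [if_neg (fun h => h1 h.1), if_neg h1, mul_zero]
      have hFc : ∀ β δ, gPeakComposition β = gPeakComposition δ → F β = F δ := by
        intro β δ h
        rw [gPeakComposition_eq_iff] at h
        simp only [F]
        rw [h.1]
        refine if_congr (and_congr_right fun hδ => forall_congr' fun i => not_congr ?_) rfl rfl
        rw [isUp_and_isDown_iff (by rwa [h.1, hδ]), isUp_and_isDown_iff (by rwa [hδ]), h.2]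
      -- Without the leading class of `α`, only classes covered by the induction hypothesis remain.
      let F' : ColPerm G n → ℤ := fun β =>
        F β - if gPeakComposition β = gPeakComposition α then 1 else 0
      have hF' : ∑ β, F' β • MonoidAlgebra.of ℤ (ColPerm G n) β ∈ N := by
        refine sum_of_mem_span_peakElement N F' (fun β δ h => ?_) fun β hβ => ?_
        · simp only [F']
          rw [hFc β δ h, h]
        · by_cases h1 : gPeakComposition β = gPeakComposition α
          · exfalso
            apply hβ
            simp only [F', if_pos h1, hFc β α h1, F]
            rw [if_pos ⟨trivial, hα⟩, sub_self]
          · simp only [F', if_neg h1, sub_zero, F] at hβ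
            obtain ⟨h2, h3⟩ : col β = col α ∧ ∀ i, ¬ (IsUp m β.right i ∧ IsDown m β.right i) := by
              by_contra h
              exact hβ (if_neg h)
            refine ih _ ?_ β rfl
            rw [← hs]
            exact (hlt β h2 h3).resolve_left fun h => h1 ((gPeakComposition_eq_iff _ _).2 ⟨h2, h⟩)
      have : peakElement n (gPeakComposition α) =
          ∑ β, F β • MonoidAlgebra.of ℤ (ColPerm G n) β -
            ∑ β, F' β • MonoidAlgebra.of ℤ (ColPerm G n) β := by
        rw [← Finset.sum_sub_distrib, peakElement, Finset.sum_filter]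
        refine Finset.sum_congr rfl fun β _ => ?_
        rw [← sub_smul]
        simp only [F', sub_sub_cancel, ite_smul, one_smul, zero_smul]
      rw [this]
      exact Submodule.sub_mem _ hF hF'
  refine Submodule.span_le.2 ?_
  rintro _ ⟨_, ⟨α, rfl⟩, rfl⟩
  exact key _ α rfl

theorem mem_peakModule_of_smul_mem (k : ℤ) (x : MonoidAlgebra ℤ (ColPerm G n)) (hk : k ≠ 0)
    (h : k • x ∈ peakModule G n) : x ∈ peakModule G n := by
  rw [mem_peakModule_iff] at h ⊢
  intro α β hαβ
  have := h α β hαβ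
  rw [MonoidAlgebra.coeff_smul_apply, MonoidAlgebra.coeff_smul_apply] at this
  exact mul_left_cancel₀ hk this

/-- The generation principle is applied once per factor, to preimages of the peak module under
multiplication maps; these inherit closure under division. -/
theorem mul_mem_peakModule {x y : MonoidAlgebra ℤ (ColPerm G n)} (hx : x ∈ peakModule G n)
    (hy : y ∈ peakModule G n) : x * y ∈ peakModule G n := by
  have h1 : ∀ (m : Fin n → Fin (n + 1)) (g : Fin (n + 1) → G), Monotone m →
      peakModule G n ≤ (peakModule G n).comap (LinearMap.mulLeft ℤ (signedElement m (g ∘ m))) := by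
    intro m g hm
    refine peakModule_le_of_signedElement_mem _ (fun k x hk h => ?_) fun m' g' _ => ?_
    · rw [Submodule.mem_comap, map_smul] at h
      exact mem_peakModule_of_smul_mem k _ hk h
    · exact signedElement_mul_mem m m' hm g g'
  have h2 : peakModule G n ≤ (peakModule G n).comap (LinearMap.mulRight ℤ y) := by
    refine peakModule_le_of_signedElement_mem _ (fun k x hk h => ?_) fun m g hm => ?_
    · rw [Submodule.mem_comap, map_smul] at h
      exact mem_peakModule_of_smul_mem k _ hk h
    · exact h1 m g hm hy
  exact h2 hx

end PeakModule

end ColouredPeak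

theorem mainTheorem1 {G : Type*} [CommGroup G] [Fintype G] [DecidableEq G] (n : ℕ) :
    LinearIndependent ℤ
        (fun c : ColouredPeak.gPeakCompositions G n => ColouredPeak.peakElement n c.1) ∧
      (∃ P : NonUnitalSubalgebra ℤ (MonoidAlgebra ℤ (ColouredPeak.ColPerm G n)),
        P.toSubmodule = ColouredPeak.peakModule G n ∧
          P.toSubmodule ≤ ColouredPeak.mantaciReutenauer G n) ∧
      (2 ≤ n → (1 : MonoidAlgebra ℤ (ColouredPeak.ColPerm G n)) ∉
        ColouredPeak.peakModule G n) := by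
  refine ⟨ColouredPeak.linearIndependent_peakElement,
    ⟨{ ColouredPeak.peakModule G n with
        mul_mem' := fun hx hy => ColouredPeak.mul_mem_peakModule hx hy }, rfl, ?_⟩,
    ColouredPeak.one_notMem_peakModule⟩
  exact ColouredPeak.peakModule_le_mantaciReutenauer
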